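/- \textbf{Definitions.} Let $D^2\subset\mathbb C$ be the closed unit disk. Let $\widetilde M$ and $M$ be closed (compact, without boundary, not necessarily connected) smooth oriented surfaces, and let $k\ge 2$. A smooth map $f:\widetilde M\to M$ is a \emph{$k$-fold simple branched covering} if for every $2\le j\le k$ there are finite sets $\widetilde V_j\subset\widetilde M$ and $V_j\subset M$ such that $f$ restricts to a bijection $\widetilde V_j\to V_j$ (the sets $\widetilde V_j$ being pairwise disjoint, and likewise the sets $V_j$), and smooth embeddings $\tilde e_{p}:D^2\to\widetilde M$ ($p\in\widetilde V_j$) and $e_{q}:D^2\to M$ ($q\in V_j$) with $\tilde e_p(0)=p$ and $e_q(0)=q$, such that: (1) $f$ has degree $k$ over each connected component of $M$; (2) $f$ is a local diffeomorphism at each point of $\widetilde M\setminus\bigcup_{j=2}^k\widetilde V_j$; (3) $f$ preserves orientation at each of its regular points; (4) for each $j$ the disks $\tilde e_p(D^2)$, $p\in\widetilde V_j$, are pairwise disjoint, and the disks $e_q(D^2)$, $q\in\bigcup_{j=2}^k V_j$, are pairwise disjoint; (5) $f(\tilde e_p(z))=e_{f(p)}(z^j)$ for all $2\le j\le k$, $p\in\widetilde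 V_j$ and $z\in D^2$. The embeddings $\tilde e_p, e_q$ need not preserve orientation; in particular, simple branched coverings whose singular points and singular values carry orientation signs are included. A \emph{singular point} of $f$ is a point at which $f$ is not a local diffeomorphism. For $j\ge2$, a point $x$ is a singular point of \emph{type} $\mathsf z^j$ if there are smooth embeddings $a:D^2\to\widetilde M$ and $b:D^2\to M$ with $a(0)=x$, $b(0)=f(x)$ and $f(a(z))=b(z^j)$ for all $z\in D^2$. \textbf{Proposition.} Let $k\ge 2$, let $\widetilde M$ be a closed oriented surface, and let $f:\widetilde M\to S^2$ be a $k$-fold simple branched covering, where $S^2$ has its standard smooth structure and either orientation. Then (a) $f$ does not have exactly one singular point; (b) $f$ does not have exactly two singular points that are of different types, that is, the set of singular points of $f$ is not of the form $\{p,q\}$ with $p\ne q$, $p$ of type $\mathsf z^j$ and $q$ of type $\mathsf z^h$ for some $j\neq h$. -/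

import Mathlib

open scoped Manifold ContDiff

/-- An orientation of a smooth surface `M` (without boundary), given by an oriented atlas: a
compatible smooth chart around every point, such that all transition maps between these charts
have positive Jacobian determinant. -/
structure SurfaceOrientation (M : Type*) [TopologicalSpace M]
    [ChartedSpace (EuclideanSpace ℝ (Fin 2)) M] where
  /-- the chosen chart around a point -/
  chart : M → OpenPartialHomeomorph M (EuclideanSpace ℝ (Fin 2))
  chart_mem : ∀ x, chart x ∈ IsManifold.maximalAtlas (𝓡 2) ∞ M
  mem_source : ∀ x, x ∈ (chart x).source
  det_pos : ∀ x y z, z ∈ (chart x).source → z ∈ (chart y).source →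
    0 < (fderiv ℝ (chart y ∘ (chart x).symm) (chart x z)).det

section

variable {M N : Type*} [TopologicalSpace M] [ChartedSpace (EuclideanSpace ℝ (Fin 2)) M]
  [TopologicalSpace N] [ChartedSpace (EuclideanSpace ℝ (Fin 2)) N]

/-- The sign (`1`, `-1` or `0`) of the Jacobian determinant of `f` at `x` in oriented charts:
`1` if `f` is an orientation-preserving local diffeomorphism at `x`, `-1` if it is an
orientation-reversing one, and `0` if the differential of `f` at `x` is singular. -/
noncomputable def jacobianSign (oM : SurfaceOrientation M) (oN : SurfaceOrientation N)
    (f : M → N) (x : M) : ℤ :=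
  (SignType.sign
    (fderiv ℝ (oN.chart (f x) ∘ f ∘ (oM.chart x).symm) (oM.chart x x)).det : ℤ)

/-- The smooth map `f` between closed oriented surfaces has degree `d` over each connected
component of the target: every regular value has `d` preimages, counted with the sign of the
Jacobian. (By Sard's theorem, there are regular values in every component of the target.) -/
def HasDegreeOverEachComponent (oM : SurfaceOrientation M) (oN : SurfaceOrientation N)
    (f : M → N) (d : ℤ) : Prop :=
  ∀ y : N, (∀ x, f x = y → Function.Surjective (mfderiv (𝓡 2) (𝓡 2) f x)) →
    ∑ᶠ x ∈ f ⁻¹' {y}, jacobianSign oM oN f x = d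

/-- `e` restricts to a smooth embedding of the closed unit disk `D²` of `ℂ` into the surface `M`:
it is smooth on a neighbourhood of the disk, and an injective immersion on the disk. -/
def IsDiskEmbedding (e : ℂ → M) : Prop :=
  (∃ U : Set ℂ, IsOpen U ∧ Metric.closedBall 0 1 ⊆ U ∧ ContMDiffOn 𝓘(ℝ, ℂ) (𝓡 2) ∞ e U) ∧
  Set.InjOn e (Metric.closedBall 0 1) ∧
  ∀ z ∈ Metric.closedBall (0 : ℂ) 1, Function.Injective (mfderiv 𝓘(ℝ, ℂ) (𝓡 2) e z)

/-- The map `f : M → N` between closed oriented surfaces is a `k`-fold simple branched covering.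

The singular submanifolds `Vs j ⊆ M` and `Vt j ⊆ N` (`2 ≤ j ≤ k`) are closed of codimension `2` in
a closed surface, i.e. they are finite sets. Disk bundles over them are disjoint unions of disks
`{p} × D²`, and the isomorphism of the bundle over `Vt j` with the `j`-th power of the bundle over
`Vs j` can be used to choose the coordinates on the fibres over `Vt j` so that the power map
between the total spaces is `(p, z) ↦ (f p, z ^ j)`.

The disk bundles are not required to be oriented, so this is the notion with unoriented singular
submanifolds. Coverings with oriented singular submanifolds are instances of it (they carry, as
additional data, a sign for each singular point and each singular value). -/
def IsSimpleBranchedCovering (k : ℕ) (oM : SurfaceOrientation M) (oN : SurfaceOrientation N)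
    (f : M → N) : Prop :=
  2 ≤ k ∧ ContMDiff (𝓡 2) (𝓡 2) ∞ f ∧
  ∃ (Vs : ℕ → Set M) (Vt : ℕ → Set N) (es : ℕ → M → ℂ → M) (et : ℕ → N → ℂ → N),
    -- the singular submanifolds: finite, pairwise disjoint, in bijection through `f`
    (∀ j ∈ Set.Icc 2 k, (Vs j).Finite ∧ (Vt j).Finite ∧ Set.BijOn f (Vs j) (Vt j)) ∧
    (Set.Icc 2 k).PairwiseDisjoint Vs ∧ (Set.Icc 2 k).PairwiseDisjoint Vt ∧
    -- the disk bundles over them are embedded, with the given points as zero sections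
    (∀ j ∈ Set.Icc 2 k, (∀ p ∈ Vs j, IsDiskEmbedding (es j p) ∧ es j p 0 = p) ∧
      (Vs j).PairwiseDisjoint (fun p => es j p '' Metric.closedBall 0 1)) ∧
    (∀ j ∈ Set.Icc 2 k, (∀ q ∈ Vt j, IsDiskEmbedding (et j q) ∧ et j q 0 = q) ∧
      (Vt j).PairwiseDisjoint (fun q => et j q '' Metric.closedBall 0 1)) ∧
    -- the degree is `k` over each component of the target
    HasDegreeOverEachComponent oM oN f k ∧
    -- `f` is a local diffeomorphism away from the singular submanifolds
    (∀ x, (∀ j ∈ Set.Icc 2 k, x ∉ Vs j) → IsLocalDiffeomorphAt (𝓡 2) (𝓡 2) ∞ f x) ∧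
    -- `f` preserves the orientation at its regular points
    (∀ x, Function.Bijective (mfderiv (𝓡 2) (𝓡 2) f x) → jacobianSign oM oN f x = 1) ∧
    -- the disk bundles in the target for different `j` are disjoint
    (∀ i ∈ Set.Icc 2 k, ∀ j ∈ Set.Icc 2 k, i ≠ j → ∀ p ∈ Vt i, ∀ q ∈ Vt j,
      Disjoint (et i p '' Metric.closedBall 0 1) (et j q '' Metric.closedBall 0 1)) ∧
    -- on the disk bundles, `f` is the `j`-th power map
    (∀ j ∈ Set.Icc 2 k, ∀ p ∈ Vs j, ∀ z ∈ Metric.closedBall (0 : ℂ) 1,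
      f (es j p z) = et j (f p) (z ^ j))

/-- The set of singular points of `f`: those at which `f` is not a local diffeomorphism. -/
def singularPoints (f : M → N) : Set M :=
  {x | ¬ IsLocalDiffeomorphAt (𝓡 2) (𝓡 2) ∞ f x}

/-- `x` is a singular point of `f` of type `z ^ j` (`j ≥ 2`): in suitable disk-shaped charts
centred at `x` and `f x`, the map `f` is `z ↦ z ^ j`. -/
def HasPowerSingularity (f : M → N) (j : ℕ) (x : M) : Prop :=
  2 ≤ j ∧ ∃ (a : ℂ → M) (b : ℂ → N), IsDiskEmbedding a ∧ IsDiskEmbedding b ∧ a 0 = x ∧ b 0 = f x ∧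
    ∀ z ∈ Metric.closedBall (0 : ℂ) 1, f (a z) = b (z ^ j)

end

open Set Filter Topology

/-! Choose `a ≠ b` in the sphere such that all singular values lie in `{a, b}`, and give each point
`x` its local degree `e x`, which is 1 at regular points. Over the complement of `{a, b}` the map is
a covering, and the base is an annulus with universal cover `ℂ`. The components of this covering are
therefore the ranges of lifts `G` of the universal cover `g`. Such a component has the same number
of sheets everywhere. Near `a` it is a punctured disk around one point `x` over `a`, so that number
is `e x`; near `b` it is likewise `e y` for a point `y` over `b`. Hence every local degree over `a`
also occurs over `b` (`exists_exponent_eq`, resting on `ncard_range_lift` and `exists_ends`).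

With `a = f p`, the degree `j ≥ 2` of `p` must occur over `b`. A single singular point leaves only
degree 1 there; a second one of type `h ≠ j` adds at most `h`. Both contradict this. -/

/-! ### The universal cover of a twice punctured sphere. -/

/-- `g` is a universal covering of the complement of `{a, b}` by the plane, with deck group
generated by the translation by `2πi`, whose right and left ends converge to `a` and `b`. -/
structure IsPuncturedUniversalCover {N : Type*} [TopologicalSpace N] (g : ℂ → N) (a b : N) :
    Prop where
  continuous : Continuous g
  isOpenMap : IsOpenMap g
  range_eq : range g = {a, b}ᶜ
  eq_iff : ∀ w w', g w = g w' ↔ ∃ n : ℤ, w = w' + n * (2 * Real.pi * Complex.I)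
  -- Left and right in the field names refer to the order of `a b`, not to the plane.
  tendsto_left : Tendsto g (comap Complex.re atTop) (𝓝 a)
  tendsto_right : Tendsto g (comap Complex.re atBot) (𝓝 b)

/-- Reflecting the plane exchanges the two ends of a punctured universal cover. -/
theorem IsPuncturedUniversalCover.comp_neg {N : Type*} [TopologicalSpace N] {g : ℂ → N} {a b : N}
    (hg : IsPuncturedUniversalCover g a b) :
    IsPuncturedUniversalCover (fun w => g (-w)) b a where
  continuous := hg.continuous.comp continuous_neg
  isOpenMap := hg.isOpenMap.comp (Homeomorph.neg ℂ).isOpenMap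
  range_eq := by
    rw [pair_comm, ← hg.range_eq]
    exact (Equiv.neg ℂ).surjective.range_comp g
  eq_iff w w' := by
    rw [hg.eq_iff]
    constructor
    · rintro ⟨n, hn⟩
      exact ⟨-n, by push_cast; linear_combination -hn⟩
    · rintro ⟨n, hn⟩
      exact ⟨-n, by push_cast; linear_combination -hn⟩
  tendsto_left := by
    refine hg.tendsto_right.comp (tendsto_comap_iff.2 ?_)
    exact (tendsto_neg_atTop_atBot.comp tendsto_comap).congr fun w => by simp
  tendsto_right := by
    refine hg.tendsto_left.comp (tendsto_comap_iff.2 ?_)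
    exact (tendsto_neg_atBot_atTop.comp tendsto_comap).congr fun w => by simp

/-- A compact Hausdorff space that is a plane with one point `a` added has, for each `b ≠ a`,
a punctured universal cover. -/
theorem exists_isPuncturedUniversalCover {N : Type*} [TopologicalSpace N] [T2Space N]
    [CompactSpace N] {a b : N} (hab : b ≠ a) (φ : OpenPartialHomeomorph N ℂ)
    (hs : φ.source = {a}ᶜ) (ht : φ.target = univ) :
    ∃ g : ℂ → N, IsPuncturedUniversalCover g a b := by
  have hb : b ∈ φ.source := by rw [hs]; exact hab
  have hinj : Function.Injective φ.symm := fun z w h =>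
    φ.symm.injOn (by simp [ht]) (by simp [ht]) h
  have hcont : Continuous φ.symm := by
    rw [← continuousOn_univ, ← ht]
    exact φ.continuousOn_symm
  -- In the coordinate `φ` the point `a` is at infinity, and `exp w + φ b` covers the plane
  -- punctured at `φ b`.
  refine ⟨fun w => φ.symm (Complex.exp w + φ b), ?_, ?_, ?_, ?_, ?_, ?_⟩
  · exact hcont.comp (Complex.continuous_exp.add continuous_const)
  · have h1 : IsOpenMap φ.symm := fun s hsO =>
      φ.symm.isOpen_image_of_subset_source hsO (by simp [ht])
    exact h1.comp ((isOpenMap_add_right (φ b)).comp Complex.isOpenMap_exp)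
  · ext y
    constructor
    · rintro ⟨w, rfl⟩ (h | h)
      · have := φ.symm.map_source (x := Complex.exp w + φ b) (by simp [ht])
        simp only [OpenPartialHomeomorph.symm_target, hs] at this
        exact this h
      · have h2 : φ.symm (Complex.exp w + φ b) = φ.symm (φ b) := by
          rw [φ.left_inv hb]; exact h
        have := hinj h2
        simp [Complex.exp_ne_zero] at this
    · intro hy
      simp only [mem_compl_iff, mem_insert_iff, mem_singleton_iff, not_or] at hy
      have hys : y ∈ φ.source := by rw [hs]; exact hy.1
      have hne : φ y - φ b ≠ 0 := fun h => hy.2 (φ.injOn hys hb (sub_eq_zero.1 h))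
      refine ⟨Complex.log (φ y - φ b), ?_⟩
      simp [Complex.exp_log hne, φ.left_inv hys]
  · intro w w'
    rw [hinj.eq_iff, add_left_inj, Complex.exp_eq_exp_iff_exists_int]
  · have h1 : Tendsto (fun w => Complex.exp w + φ b) (comap Complex.re atTop) (cocompact ℂ) := by
      have := (Homeomorph.addRight (φ b)).isClosedEmbedding.tendsto_cocompact
      refine this.comp ?_
      rw [← Metric.cobounded_eq_cocompact]
      exact Complex.tendsto_exp_comap_re_atTop
    refine Tendsto.comp (y := cocompact ℂ) ?_ h1
    rw [(nhds_basis_opens a).tendsto_right_iff]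
    rintro D ⟨haD, hD⟩
    have hK : IsCompact (φ '' Dᶜ) := by
      refine hD.isClosed_compl.isCompact.image_of_continuousOn (φ.continuousOn.mono ?_)
      rw [hs]
      exact compl_subset_compl.2 (singleton_subset_iff.2 haD)
    filter_upwards [hK.compl_mem_cocompact] with z hz
    by_contra hzD
    exact hz ⟨φ.symm z, hzD, φ.right_inv (by simp [ht])⟩
  · have h1 : Tendsto (fun w => Complex.exp w + φ b) (comap Complex.re atBot) (𝓝 (0 + φ b)) :=
      Complex.tendsto_exp_comap_re_atBot.add_const _
    have h2 := (hcont.tendsto (0 + φ b)).comp h1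
    rwa [zero_add, φ.left_inv hb] at h2

/-! ### Uniqueness and openness of lifts. -/

section Lifts

variable {M N : Type*} [TopologicalSpace M] [TopologicalSpace N] {f : M → N} {g G : ℂ → M}

/-- Two lifts of a plane through a covering that agree at a point are equal. -/
theorem IsCoveringMapOn.lift_eq {s : Set N} (hf : IsCoveringMapOn f s) {G₁ G₂ : ℂ → M}
    (h₁ : Continuous G₁) (h₂ : Continuous G₂) (he : ∀ w, f (G₁ w) = f (G₂ w))
    (hs : ∀ w, f (G₁ w) ∈ s) (w₀ : ℂ) (h₀ : G₁ w₀ = G₂ w₀) : G₁ = G₂ := by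
  have hc : Continuous (fun w => f (G₁ w)) := continuous_iff_continuousAt.2 fun w =>
    ContinuousAt.comp (hf.continuousAt (hs w)) h₁.continuousAt
  obtain ⟨F, -, hF⟩ := hf.existsUnique_continuousMap_lifts (⟨_, hc⟩ : C(ℂ, N)) (a₀ := w₀)
    (e₀ := G₁ w₀) rfl hs
  have e1 := hF ⟨G₁, h₁⟩ ⟨rfl, rfl⟩
  have e2 := hF ⟨G₂, h₂⟩ ⟨h₀.symm, funext fun w => (he w).symm⟩
  exact congrArg DFunLike.coe (e1.trans e2.symm)

/-- A continuous lift of an open map through a local homeomorphism is open. -/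
theorem IsLocalHomeomorphOn.isOpenMap_lift {A : Type*} [TopologicalSpace A] {s : Set N}
    (hf : IsLocalHomeomorphOn f (f ⁻¹' s)) {G : A → M} (hG : Continuous G)
    (ho : IsOpenMap (f ∘ G)) (hs : ∀ w, f (G w) ∈ s) : IsOpenMap G := by
  rw [isOpenMap_iff_nhds_le]
  intro w
  obtain ⟨φ, hφ, hfφ⟩ := hf (G w) (hs w)
  have h1 : 𝓝 (G w) = map φ.symm (𝓝 (φ (G w))) := (φ.symm_map_nhds_eq hφ).symm
  have h2 : 𝓝 (φ (G w)) ≤ map (f ∘ G) (𝓝 w) := by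
    rw [← hfφ]; exact isOpenMap_iff_nhds_le.1 ho w
  rw [h1]
  refine (map_mono h2).trans ?_
  rw [map_map]
  refine le_of_eq (map_congr ?_)
  filter_upwards [hG.continuousAt.preimage_mem_nhds (φ.open_source.mem_nhds hφ)] with v hv
  rw [Function.comp_apply, Function.comp_apply, hfφ, φ.left_inv hv]

end Lifts

/-! ### Ranges of lifts as components of the covering. -/

section Fibres

variable {M N : Type*} [TopologicalSpace M] [TopologicalSpace N] {f : M → N} {g : ℂ → N} {a b : N}
  {G : ℂ → M}

theorem IsPuncturedUniversalCover.mem_compl (hg : IsPuncturedUniversalCover g a b) (w : ℂ) :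
    g w ∈ ({a, b} : Set N)ᶜ := hg.range_eq ▸ mem_range_self w

/-- Lifts exist because the plane is simply connected. -/
theorem IsPuncturedUniversalCover.exists_lift (hg : IsPuncturedUniversalCover g a b)
    (hf : IsCoveringMapOn f {a, b}ᶜ) {x : M} {w : ℂ} (hx : f x = g w) :
    ∃ G : ℂ → M, Continuous G ∧ (∀ v, f (G v) = g v) ∧ G w = x := by
  obtain ⟨F, ⟨h1, h2⟩, -⟩ := hf.existsUnique_continuousMap_lifts (⟨g, hg.continuous⟩ : C(ℂ, N))
    (a₀ := w) (e₀ := x) hx hg.mem_compl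
  exact ⟨F, F.continuous, fun v => congrFun h2 v, h1⟩

theorem IsPuncturedUniversalCover.isOpen_range_lift (hg : IsPuncturedUniversalCover g a b)
    (hf : IsCoveringMapOn f {a, b}ᶜ) (hG : Continuous G) (hfG : ∀ v, f (G v) = g v) :
    IsOpen (range G) := by
  refine (hf.isLocalHomeomorphOn.isOpenMap_lift hG ?_ fun w => ?_).isOpen_range
  · rw [show f ∘ G = g from funext hfG]; exact hg.isOpenMap
  · rw [hfG]; exact hg.mem_compl w

theorem IsPuncturedUniversalCover.apply_add (hg : IsPuncturedUniversalCover g a b) (w : ℂ)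
    (n : ℤ) : g (w + n * (2 * Real.pi * Complex.I)) = g w :=
  (hg.eq_iff _ _).2 ⟨n, rfl⟩

omit [TopologicalSpace M] in
/-- The part of a fibre that lies in the range of a lift. -/
theorem IsPuncturedUniversalCover.range_lift_inter (hg : IsPuncturedUniversalCover g a b)
    (hfG : ∀ v, f (G v) = g v) (w : ℂ) :
    range G ∩ f ⁻¹' {g w} = range fun n : ℤ => G (w + n * (2 * Real.pi * Complex.I)) := by
  ext x
  constructor
  · rintro ⟨⟨v, rfl⟩, hv⟩
    obtain ⟨n, rfl⟩ := (hg.eq_iff v w).1 ((hfG v).symm.trans hv)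
    exact ⟨n, rfl⟩
  · rintro ⟨n, rfl⟩
    exact ⟨⟨_, rfl⟩, by simp [hfG, hg.apply_add]⟩

/-- The ranges of two lifts are equal or disjoint. -/
theorem IsPuncturedUniversalCover.range_lift_subset (hg : IsPuncturedUniversalCover g a b)
    (hf : IsCoveringMapOn f {a, b}ᶜ) {G' : ℂ → M} (hG : Continuous G) (hfG : ∀ v, f (G v) = g v)
    (hG' : Continuous G') (hfG' : ∀ v, f (G' v) = g v) (h : (range G ∩ range G').Nonempty) :
    range G' ⊆ range G := by
  obtain ⟨_, ⟨v, rfl⟩, v', hv⟩ := h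
  obtain ⟨n, rfl⟩ := (hg.eq_iff v v').1 (by rw [← hfG, ← hfG', hv])
  -- A deck translate of `G` is again a lift, and it meets `G'` at `v'`.
  have := hf.lift_eq hG' (G₂ := fun w => G (w + n * (2 * Real.pi * Complex.I)))
    (by fun_prop) (fun w => by rw [hfG, hfG', hg.apply_add])
    (fun w => by rw [hfG']; exact hg.mem_compl w) v' hv
  rw [this]
  rintro _ ⟨w, rfl⟩
  exact mem_range_self _

/-- A connected set of regular points that meets the range of a lift is contained in it. -/
theorem IsPuncturedUniversalCover.subset_range_lift (hg : IsPuncturedUniversalCover g a b)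
    (hf : IsCoveringMapOn f {a, b}ᶜ) (hG : Continuous G) (hfG : ∀ v, f (G v) = g v) {T : Set M}
    (hT : IsPreconnected T) (hTf : T ⊆ f ⁻¹' {a, b}ᶜ) (hTG : (T ∩ range G).Nonempty) :
    T ⊆ range G := by
  -- `V` is open and, with `range G`, covers all of `f ⁻¹' {a, b}ᶜ`; so `range G` is clopen there.
  let V : Set M := ⋃ G' ∈ {G' : ℂ → M | Continuous G' ∧ (∀ v, f (G' v) = g v) ∧
    Disjoint (range G) (range G')}, range G'
  refine hT.subset_left_of_subset_union (v := V) (hg.isOpen_range_lift hf hG hfG) ?_ ?_ ?_ hTG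
  · exact isOpen_biUnion fun G' hG' => hg.isOpen_range_lift hf hG'.1 hG'.2.1
  · exact disjoint_iUnion₂_right.2 fun G' hG' => hG'.2.2
  · intro x hx
    have := hTf hx
    rw [mem_preimage, ← hg.range_eq] at this
    obtain ⟨w, hw⟩ := this
    obtain ⟨G', h1, h2, rfl⟩ := hg.exists_lift hf hw.symm
    by_cases hd : Disjoint (range G) (range G')
    · exact Or.inr (mem_iUnion₂.2 ⟨G', ⟨h1, h2, hd⟩, mem_range_self _⟩)
    · exact Or.inl (hg.range_lift_subset hf hG hfG h1 h2
        (not_disjoint_iff_nonempty_inter.1 hd) (mem_range_self _))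

/-- The number of sheets of the range of a lift is constant. -/
theorem IsPuncturedUniversalCover.ncard_range_lift (hg : IsPuncturedUniversalCover g a b)
    (hf : IsCoveringMapOn f {a, b}ᶜ) (hG : Continuous G) (hfG : ∀ v, f (G v) = g v) (w w' : ℂ) :
    (range G ∩ f ⁻¹' {g w}).ncard = (range G ∩ f ⁻¹' {g w'}).ncard := by
  rw [hg.range_lift_inter hfG, hg.range_lift_inter hfG, ← Nat.card_coe_set_eq,
    ← Nat.card_coe_set_eq]
  -- Two deck translates of `G` that agree at one point agree everywhere, so both fibres are the
  -- quotient of `ℤ` by the same relation.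
  have key : ∀ (v v' : ℂ) (n m : ℤ), G (v + n * (2 * Real.pi * Complex.I)) =
      G (v + m * (2 * Real.pi * Complex.I)) → G (v' + n * (2 * Real.pi * Complex.I)) =
      G (v' + m * (2 * Real.pi * Complex.I)) := by
    intro v v' n m h
    exact congrFun (hf.lift_eq (G₁ := fun u => G (u + n * (2 * Real.pi * Complex.I)))
      (G₂ := fun u => G (u + m * (2 * Real.pi * Complex.I))) (by fun_prop) (by fun_prop)
      (fun u => by simp only [hfG, hg.apply_add])
      (fun u => by simp only [hfG, hg.apply_add]; exact hg.mem_compl u) v h) v'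
  refine Nat.card_congr ((Setoid.quotientKerEquivRange _).symm.trans
    ((Quotient.congrRight fun n m => ?_).trans (Setoid.quotientKerEquivRange _)))
  exact ⟨key w w' n m, key w' w n m⟩

end Fibres

/-! ### Local power maps. -/

/-- In suitable local coordinates centred at `x` and `f x`, the map `f` is `z ↦ z ^ d`. -/
def IsLocallyPowerAt {M N : Type*} [TopologicalSpace M] [TopologicalSpace N] (f : M → N) (d : ℕ)
    (x : M) : Prop :=
  ∃ (α : OpenPartialHomeomorph ℂ M) (β : OpenPartialHomeomorph ℂ N), 0 ∈ α.source ∧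
    0 ∈ β.source ∧ α 0 = x ∧ β 0 = f x ∧ ∀ᶠ z in 𝓝 0, f (α z) = β (z ^ d)

/-- A punctured disk is connected. -/
theorem Complex.isPreconnected_ball_diff_singleton {r : ℝ} (hr : 0 < r) :
    IsPreconnected (Metric.ball (0 : ℂ) r \ {0}) := by
  have : Metric.ball (0 : ℂ) r \ {0} = Complex.exp '' {w : ℂ | w.re < Real.log r} := by
    ext z
    constructor
    · rintro ⟨hz, hz0 : z ≠ 0⟩
      refine ⟨Complex.log z, ?_, Complex.exp_log hz0⟩
      rw [mem_ofPred_eq, Complex.log_re]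
      exact Real.log_lt_log (norm_pos_iff.2 hz0) (by simpa using hz)
    · rintro ⟨w, hw, rfl⟩
      refine ⟨?_, Complex.exp_ne_zero w⟩
      rw [mem_ball_zero_iff, Complex.norm_exp]
      exact (Real.lt_log_iff_exp_lt hr).1 hw
  rw [this]
  exact (convex_halfSpace_re_lt _).isPreconnected.image _ Complex.continuous_exp.continuousOn

/-- A nonzero complex number has exactly `d` roots of order `d`. -/
theorem Complex.ncard_setOf_pow_eq {d : ℕ} (hd : d ≠ 0) {ζ : ℂ} (hζ : ζ ≠ 0) :
    {z : ℂ | z ^ d = ζ}.ncard = d := by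
  classical
  have hp := Complex.isPrimitiveRoot_exp d hd
  have hex : ∃ α : ℂ, α ^ d = ζ := IsAlgClosed.exists_pow_nat_eq ζ (Nat.pos_of_ne_zero hd)
  have h1 : {z : ℂ | z ^ d = ζ} = ((Polynomial.nthRoots d ζ).toFinset : Set ℂ) := by
    ext z
    simp [Polynomial.mem_nthRoots (Nat.pos_of_ne_zero hd)]
  rw [h1, Set.ncard_coe_finset, Multiset.toFinset_card_of_nodup (hp.nthRoots_nodup hζ),
    hp.card_nthRoots, if_pos hex]

/-- Near a point where `f` is `z ↦ z ^ d` in coordinates, there are arbitrarily small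
neighbourhoods `U` that stay connected when punctured and cover punctured neighbourhoods of the
value `d` times. -/
theorem IsLocallyPowerAt.exists_isOpen {M N : Type*} [TopologicalSpace M] [TopologicalSpace N]
    {f : M → N} {d : ℕ} {x : M} (h : IsLocallyPowerAt f d x) (hd : d ≠ 0) {W : Set M}
    (hW : W ∈ 𝓝 x) :
    ∃ U ⊆ W, IsOpen U ∧ x ∈ U ∧ IsPreconnected (U \ {x}) ∧ (∀ y ∈ U, f y = f x → y = x) ∧
      ∀ᶠ y in 𝓝 (f x), y ≠ f x → (U ∩ f ⁻¹' {y}).ncard = d := by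
  obtain ⟨α, β, hα, hβ, rfl, hβ0, hf⟩ := h
  have hpow : Tendsto (fun z : ℂ => z ^ d) (𝓝 0) (𝓝 0) := by
    have := (continuous_pow d).tendsto (0 : ℂ)
    rwa [zero_pow hd] at this
  have hev : ∀ᶠ z in 𝓝 (0 : ℂ), z ∈ α.source ∧ α z ∈ W ∧ f (α z) = β (z ^ d) :=
    (α.open_source.eventually_mem hα).and (((α.continuousAt hα).eventually_mem hW).and hf)
  obtain ⟨s, hs, hsβ⟩ := Metric.mem_nhds_iff.1 (β.open_source.mem_nhds hβ)
  obtain ⟨r, hr, hrα⟩ := Metric.mem_nhds_iff.1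
    (hev.and (hpow.eventually (Metric.ball_mem_nhds 0 hs)))
  have hrα' : Metric.ball 0 r ⊆ α.source := fun z hz => (hrα hz).1.1
  have h0 : (0 : ℂ) ∈ Metric.ball 0 r := Metric.mem_ball_self hr
  have hinj : InjOn α (Metric.ball 0 r) := α.injOn.mono hrα'
  have hval : ∀ z ∈ Metric.ball (0 : ℂ) r, f (α z) = β (z ^ d) := fun z hz => (hrα hz).1.2.2
  have hpb : ∀ z ∈ Metric.ball (0 : ℂ) r, z ^ d ∈ β.source := fun z hz => hsβ (hrα hz).2
  refine ⟨α '' Metric.ball 0 r, ?_, ?_, mem_image_of_mem _ h0, ?_, ?_, ?_⟩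
  · rintro _ ⟨z, hz, rfl⟩
    exact (hrα hz).1.2.1
  · exact α.isOpen_image_of_subset_source Metric.isOpen_ball hrα'
  · have : α '' Metric.ball 0 r \ {α 0} = α '' (Metric.ball 0 r \ {0}) := by
      rw [hinj.image_sdiff_subset (singleton_subset_iff.2 h0), image_singleton]
    rw [this]
    exact (Complex.isPreconnected_ball_diff_singleton hr).image _
      (α.continuousOn.mono (sdiff_subset.trans hrα'))
  · rintro _ ⟨z, hz, rfl⟩ hz'
    rw [hval z hz, ← hβ0] at hz'
    have := β.injOn (hpb z hz) hβ hz'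
    rw [pow_eq_zero_iff hd] at this
    rw [this]
  · let t : Set ℂ := β.source ∩ Metric.ball 0 (r ^ d)
    have ht : β '' t ∈ 𝓝 (f (α 0)) := by
      rw [← hβ0]
      refine (β.isOpen_image_of_subset_source (β.open_source.inter Metric.isOpen_ball)
        inter_subset_left).mem_nhds (mem_image_of_mem _ ⟨hβ, Metric.mem_ball_self (by positivity)⟩)
    filter_upwards [ht]
    rintro _ ⟨ζ, ⟨hζ1, hζ2⟩, rfl⟩ hζ
    have hζ0 : ζ ≠ 0 := by
      rintro rfl
      exact hζ hβ0
    have hroot : ∀ z : ℂ, z ^ d = ζ → z ∈ Metric.ball (0 : ℂ) r := by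
      rintro z rfl
      rw [mem_ball_zero_iff, norm_pow] at hζ2
      rw [mem_ball_zero_iff]
      exact lt_of_pow_lt_pow_left₀ d hr.le hζ2
    have : α '' Metric.ball 0 r ∩ f ⁻¹' {β ζ} = α '' {z : ℂ | z ^ d = ζ} := by
      ext y
      constructor
      · rintro ⟨⟨z, hz, rfl⟩, hy⟩
        refine ⟨z, β.injOn (hpb z hz) hζ1 ?_, rfl⟩
        rw [← hval z hz]
        exact hy
      · rintro ⟨z, hz, rfl⟩
        refine ⟨⟨z, hroot z hz, rfl⟩, ?_⟩
        rw [mem_preimage, hval z (hroot z hz), hz, mem_singleton_iff]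
    have hinj' : InjOn α {z : ℂ | z ^ d = ζ} := hinj.mono hroot
    rw [this, hinj'.ncard_image, Complex.ncard_setOf_pow_eq hd hζ0]

/-! ### The ends of the covering and their local degrees. -/

section Ends

variable {M N : Type*} [TopologicalSpace M] [T2Space M] [CompactSpace M] [TopologicalSpace N]
  [T2Space N] {f : M → N} {g : ℂ → N} {a b : N}

/-- If `f` is locally a power map at the points over `a`, then over a neighbourhood of the end of
the punctured cover at `a` the total space is a union of disjoint sets `U x`, for `x` over `a`,
such that the range of a lift that meets `U x` there has `e x` sheets. -/
theorem IsPuncturedUniversalCover.exists_ends (hg : IsPuncturedUniversalCover g a b)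
    (hf : Continuous f) (hcov : IsCoveringMapOn f {a, b}ᶜ) (hab : a ≠ b) (e : M → ℕ)
    (he : ∀ x, e x ≠ 0) (hp : ∀ x, f x = a → IsLocallyPowerAt f (e x) x) :
    ∃ (U : M → Set M) (w : ℂ), f ⁻¹' {g w} ⊆ ⋃ x ∈ f ⁻¹' {a}, U x ∧
      (∀ x, f x = a → (U x ∩ f ⁻¹' {g w}).Nonempty) ∧
      ∀ G : ℂ → M, Continuous G → (∀ v, f (G v) = g v) → ∀ x, f x = a → G w ∈ U x →
        ∀ v, (range G ∩ f ⁻¹' {g v}).ncard = e x := by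
  have hfin : (f ⁻¹' {a}).Finite := by
    have hc : IsCompact (f ⁻¹' {a}) := (isClosed_singleton.preimage hf).isCompact
    -- The fibre is compact, and discrete because a local power map takes its central value only at
    -- the centre.
    refine hc.finite (isDiscrete_iff_forall_mem_exists_isOpen.2 fun x hx => ?_)
    obtain ⟨U, -, hU, hxU, -, hinj, -⟩ := (hp x hx).exists_isOpen (he x) univ_mem
    refine ⟨U, hU, subset_antisymm (fun y hy => hinj y hy.1 (hy.2.trans hx.symm)) ?_⟩
    rintro _ rfl
    exact ⟨hxU, hx⟩
  obtain ⟨W, hW, hdisj⟩ := hfin.t2_separation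
  have hU : ∀ x, ∃ U : Set M, f x = a → (U ⊆ W x ∩ f ⁻¹' {b}ᶜ ∧ IsOpen U ∧ x ∈ U ∧
      IsPreconnected (U \ {x}) ∧ (∀ y ∈ U, f y = f x → y = x) ∧
      ∀ᶠ y in 𝓝 (f x), y ≠ f x → (U ∩ f ⁻¹' {y}).ncard = e x) := by
    intro x
    by_cases hx : f x = a
    · obtain ⟨U, h⟩ := (hp x hx).exists_isOpen (he x) (W := W x ∩ f ⁻¹' {b}ᶜ)
        (((hW x).2.inter (isOpen_compl_singleton.preimage hf)).mem_nhds
          ⟨(hW x).1, by simpa [hx] using hab⟩)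
      exact ⟨U, fun _ => h⟩
    · exact ⟨∅, fun h => absurd h hx⟩
  choose U hU using hU
  have hcount : ∀ᶠ y in 𝓝 a, ∀ x ∈ f ⁻¹' {a}, y ≠ a → (U x ∩ f ⁻¹' {y}).ncard = e x :=
    (hfin.eventually_all).2 fun x hx => by
      have h := (hU x hx).2.2.2.2.2
      rwa [show f x = a from hx] at h
  have hcover : ∀ᶠ y in 𝓝 a, f ⁻¹' {y} ⊆ ⋃ x ∈ f ⁻¹' {a}, U x := by
    have hO : IsOpen (⋃ x ∈ f ⁻¹' {a}, U x) := isOpen_biUnion fun x hx => (hU x hx).2.1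
    -- Since `M` is compact, `f` is closed: fibres near `a` cannot leave the union of the `U x`.
    have hK : IsClosed (f '' (⋃ x ∈ f ⁻¹' {a}, U x)ᶜ) :=
      (hO.isClosed_compl.isCompact.image hf).isClosed
    have ha : a ∈ (f '' (⋃ x ∈ f ⁻¹' {a}, U x)ᶜ)ᶜ := by
      rintro ⟨x, hxU, hx⟩
      exact hxU (mem_iUnion₂.2 ⟨x, hx, (hU x hx).2.2.1⟩)
    filter_upwards [hK.isOpen_compl.mem_nhds ha] with y hy x hx
    by_contra hxU
    exact hy ⟨x, hxU, hx⟩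
  have hev := hg.tendsto_left.eventually (hcount.and hcover)
  rw [eventually_comap] at hev
  obtain ⟨R, hR⟩ := eventually_atTop.1 hev
  replace hR : ∀ w : ℂ, R ≤ w.re → (∀ x ∈ f ⁻¹' {a}, (U x ∩ f ⁻¹' {g w}).ncard = e x) ∧
      f ⁻¹' {g w} ⊆ ⋃ x ∈ f ⁻¹' {a}, U x := fun w hw =>
    ⟨fun x hx => (hR _ hw w rfl).1 x hx fun h => hg.mem_compl w (Or.inl h), (hR _ hw w rfl).2⟩
  have hH : IsPreconnected {w : ℂ | R ≤ w.re} := (convex_halfSpace_re_ge R).isPreconnected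
  refine ⟨U, (R : ℂ), (hR R (by simp)).2, fun x hx => ?_, ?_⟩
  · refine nonempty_of_ncard_ne_zero ?_
    rw [(hR R (by simp)).1 x hx]
    exact he x
  intro G hG hfG x hx hGx v
  obtain ⟨hUW, hUo, -, hUc, hUi, -⟩ := hU x hx
  -- The image of the half-plane is connected and lies in the disjoint open sets `U y`, hence in
  -- only one of them.
  have hGH : G '' {w : ℂ | R ≤ w.re} ⊆ U x := by
    refine (hH.image G hG.continuousOn).subset_left_of_subset_union
      (v := ⋃ y ∈ f ⁻¹' {a} \ {x}, U y) hUo (isOpen_biUnion fun y hy => (hU y hy.1).2.1) ?_ ?_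
      ⟨_, ⟨R, by simp, rfl⟩, hGx⟩
    · refine disjoint_iUnion₂_right.2 fun y hy => ?_
      refine (hdisj hx hy.1 (Ne.symm hy.2)).mono (hUW.trans inter_subset_left)
        ((hU y hy.1).1.trans inter_subset_left)
    · rintro _ ⟨w, hw, rfl⟩
      obtain ⟨y, hy, hyU⟩ := mem_iUnion₂.1 ((hR w hw).2 (hfG w))
      by_cases hyx : y = x
      · exact Or.inl (hyx ▸ hyU)
      · exact Or.inr (mem_iUnion₂.2 ⟨y, ⟨hy, hyx⟩, hyU⟩)
  -- It remains to see that `range G` and `U x` meet the fibre over `g R` in the same set. Deck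
  -- translations preserve the half-plane, which gives one inclusion; connectedness of the punctured
  -- `U x` gives the other.
  rw [hg.ncard_range_lift hcov hG hfG v R, ← (hR R (by simp)).1 x hx]
  congr 1
  refine subset_antisymm ?_ fun y hy => ⟨?_, hy.2⟩
  · intro y hy
    refine ⟨?_, hy.2⟩
    rw [hg.range_lift_inter hfG] at hy
    obtain ⟨n, rfl⟩ := hy
    exact hGH ⟨_, by simp, rfl⟩
  · have hne : ∀ z, f z = g R → z ≠ x := by
      rintro z hz rfl
      exact hg.mem_compl R (Or.inl (hz.symm.trans hx))
    refine hg.subset_range_lift hcov hG hfG hUc ?_ ⟨G R, ⟨hGx, hne _ (hfG R)⟩, mem_range_self _⟩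
      ⟨hy.1, hne y hy.2⟩
    rintro z ⟨hz, hzx⟩ (h | h)
    · exact hzx (hUi z hz (h.trans hx.symm))
    · exact (hUW hz).2 h

/-- If all points over `a` and `b` are local power maps, and `f` is a local homeomorphism
elsewhere, then every exponent over `a` occurs over `b`. -/
theorem IsPuncturedUniversalCover.exists_exponent_eq (hg : IsPuncturedUniversalCover g a b)
    (hf : Continuous f) (hloc : IsLocalHomeomorphOn f (f ⁻¹' {a, b}ᶜ)) (hab : a ≠ b) (e : M → ℕ)
    (he : ∀ x, e x ≠ 0) (ha : ∀ x, f x = a → IsLocallyPowerAt f (e x) x)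
    (hb : ∀ x, f x = b → IsLocallyPowerAt f (e x) x) (p : M) (hp : f p = a) :
    ∃ x, f x = b ∧ e x = e p := by
  have hcov : IsCoveringMapOn f {a, b}ᶜ := .of_isLocalHomeomorphOn hf hloc
  obtain ⟨U, w, -, hne, hU⟩ := hg.exists_ends hf hcov hab e he ha
  obtain ⟨x₀, hx₀, hx₀w⟩ := hne p hp
  obtain ⟨G, hG, hfG, rfl⟩ := hg.exists_lift hcov hx₀w
  -- Reflecting the plane turns the end at `b` into the one already treated.
  obtain ⟨V, w', hcover, -, hV⟩ := hg.comp_neg.exists_ends hf (pair_comm a b ▸ hcov) hab.symm e he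
    hb
  obtain ⟨x, hx, hxV⟩ := mem_iUnion₂.1 (hcover (hfG (-w')))
  refine ⟨x, hx, ?_⟩
  rw [← hU G hG hfG p hp hx₀ 0, ← hV (fun v => G (-v)) (hG.comp continuous_neg)
    (fun v => hfG (-v)) x hx hxV 0]
  simp only [neg_zero]
  congr 2
  exact (Equiv.neg ℂ).surjective.range_comp G

end Ends

/-! ### From smooth disks and local diffeomorphisms to local power maps. -/

section Surfaces

variable {M N : Type*} [TopologicalSpace M] [ChartedSpace (EuclideanSpace ℝ (Fin 2)) M]
  [TopologicalSpace N] [ChartedSpace (EuclideanSpace ℝ (Fin 2)) N]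

/-- An embedded disk in a surface is a local parametrization near its centre. -/
theorem IsDiskEmbedding.exists_openPartialHomeomorph {a : ℂ → M} (ha : IsDiskEmbedding a) :
    ∃ α : OpenPartialHomeomorph ℂ M, 0 ∈ α.source ∧ ∀ᶠ z in 𝓝 0, α z = a z := by
  obtain ⟨⟨U, hU, hsub, hsm⟩, -, himm⟩ := ha
  have h0 : (0 : ℂ) ∈ Metric.closedBall (0 : ℂ) 1 := Metric.mem_closedBall_self zero_le_one
  have hat : ContMDiffAt 𝓘(ℝ, ℂ) (𝓡 2) ∞ a 0 := hsm.contMDiffAt (hU.mem_nhds (hsub h0))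
  set c := chartAt (EuclideanSpace ℝ (Fin 2)) (a 0) with hc
  have hcd : ContDiffAt ℝ ∞ (c ∘ a) 0 := by
    exact contMDiffAt_iff_contDiffAt.1 (contMDiffAt_iff_target.1 hat).2
  have hder : Function.Injective (fderiv ℝ (c ∘ a) 0) := by
    have := himm 0 h0
    rw [(hat.mdifferentiableAt (by simp)).mfderiv] at this
    rw [← fderivWithin_univ, ← range_id]
    exact this
  have hrank : Module.finrank ℝ ℂ = Module.finrank ℝ (EuclideanSpace ℝ (Fin 2)) := by simp
  let L : ℂ ≃L[ℝ] EuclideanSpace ℝ (Fin 2) :=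
    (LinearEquiv.ofInjectiveOfFinrankEq (fderiv ℝ (c ∘ a) 0).toLinearMap hder
      hrank).toContinuousLinearEquiv
  have hL : HasFDerivAt (c ∘ a) (L : ℂ →L[ℝ] EuclideanSpace ℝ (Fin 2)) 0 := by
    have h1 := (hcd.differentiableAt (by simp)).hasFDerivAt
    have h2 : (L : ℂ →L[ℝ] EuclideanSpace ℝ (Fin 2)) = fderiv ℝ (c ∘ a) 0 := by
      ext1
      all_goals rfl
    rwa [h2]
  -- Inverse function theorem: the injective differential is invertible since both dimensions are 2.
  let ψ := hcd.toOpenPartialHomeomorph (c ∘ a) hL (by simp)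
  have hψ : ∀ z, ψ z = c (a z) := fun z => rfl
  have hmem : a 0 ∈ c.source := mem_chart_source _ _
  refine ⟨ψ.trans c.symm, ?_, ?_⟩
  · rw [OpenPartialHomeomorph.trans_source]
    refine ⟨hcd.mem_toOpenPartialHomeomorph_source hL (by simp), ?_⟩
    rw [mem_preimage, hψ]
    exact c.map_source hmem
  · filter_upwards [hat.continuousAt.eventually_mem (c.open_source.mem_nhds hmem)] with z hz
    rw [OpenPartialHomeomorph.coe_trans, Function.comp_apply, hψ, c.left_inv hz]

theorem HasPowerSingularity.isLocallyPowerAt {f : M → N} {j : ℕ} {x : M}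
    (h : HasPowerSingularity f j x) : IsLocallyPowerAt f j x := by
  obtain ⟨hj, a, b, ha, hb, rfl, hb0, hab⟩ := h
  obtain ⟨α, hα, hαa⟩ := ha.exists_openPartialHomeomorph
  obtain ⟨β, hβ, hβb⟩ := hb.exists_openPartialHomeomorph
  have hpow : Tendsto (fun z : ℂ => z ^ j) (𝓝 0) (𝓝 0) := by
    have := (continuous_pow j).tendsto (0 : ℂ)
    rwa [zero_pow (by lia)] at this
  refine ⟨α, β, hα, hβ, hαa.self_of_nhds, hβb.self_of_nhds.trans hb0, ?_⟩
  filter_upwards [hαa, hpow.eventually hβb, Metric.closedBall_mem_nhds (0 : ℂ) one_pos]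
    with z h1 h2 h3
  rw [h1, h2, hab z h3]

/-- The homeomorphism between open sets underlying a partial diffeomorphism. -/
theorem IsLocalDiffeomorphAt.exists_openPartialHomeomorph {f : M → N} {x : M}
    (h : IsLocalDiffeomorphAt (𝓡 2) (𝓡 2) ∞ f x) :
    ∃ φ : OpenPartialHomeomorph M N, x ∈ φ.source ∧ EqOn f φ φ.source := by
  obtain ⟨Φ, hx, hΦ⟩ := h
  exact ⟨{ Φ.toPartialEquiv with
    open_source := Φ.open_source
    open_target := Φ.open_target
    continuousOn_toFun := Φ.contMDiffOn_toFun.continuousOn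
    continuousOn_invFun := Φ.contMDiffOn_invFun.continuousOn }, hx, hΦ⟩

/-- Regular points thus enter the sheet count with exponent 1. -/
theorem IsLocalDiffeomorphAt.isLocallyPowerAt {f : M → N} {x : M}
    (h : IsLocalDiffeomorphAt (𝓡 2) (𝓡 2) ∞ f x) : IsLocallyPowerAt f 1 x := by
  obtain ⟨φ, hx, hφ⟩ := h.exists_openPartialHomeomorph
  let c := chartAt (EuclideanSpace ℝ (Fin 2)) x
  have hxc : x ∈ c.source := mem_chart_source _ _
  let T : ℂ ≃ₜ EuclideanSpace ℝ (Fin 2) :=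
    (Complex.orthonormalBasisOneI.repr.toHomeomorph).trans (Homeomorph.addRight (c x))
  have hT : T 0 = c x := by simp [T]
  let α : OpenPartialHomeomorph ℂ M := T.toOpenPartialHomeomorph.trans c.symm
  have hα0 : α 0 = x := by simp [α, hT, c.left_inv hxc]
  have hα : 0 ∈ α.source := by simp [α, hT, c.map_source hxc]
  refine ⟨α, α.trans φ, hα, ?_, hα0, ?_, ?_⟩
  · rw [OpenPartialHomeomorph.trans_source]
    exact ⟨hα, by rwa [mem_preimage, hα0]⟩
  · rw [OpenPartialHomeomorph.coe_trans, Function.comp_apply, hα0, hφ hx]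
  · have := (α.continuousAt hα).eventually_mem (φ.open_source.mem_nhds (hα0.symm ▸ hx))
    filter_upwards [this] with z hz
    rw [pow_one, hφ hz]
    rfl

end Surfaces

/-! ### Maps to the sphere and the main theorem. -/

/-- The sphere minus a pair of distinct points has the plane as universal covering. -/
theorem exists_isPuncturedUniversalCover_sphere
    {a b : Metric.sphere (0 : EuclideanSpace ℝ (Fin 3)) 1} (hab : b ≠ a) :
    ∃ g, IsPuncturedUniversalCover g a b :=
  have : Fact (Module.finrank ℝ (EuclideanSpace ℝ (Fin 3)) = 2 + 1) := ⟨by simp⟩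
  exists_isPuncturedUniversalCover hab
    ((stereographic' 2 a).trans
      Complex.orthonormalBasisOneI.repr.symm.toHomeomorph.toOpenPartialHomeomorph)
    (by simp) (by simp)

/-- If the singular points of a map to the sphere are local power maps and lie over two points
`a`, `b`, then every local degree over `a` occurs over `b`. -/
theorem exists_exponent_eq_of_sphere {M : Type*} [TopologicalSpace M] [T2Space M] [CompactSpace M]
    [ChartedSpace (EuclideanSpace ℝ (Fin 2)) M]
    {f : M → Metric.sphere (0 : EuclideanSpace ℝ (Fin 3)) 1} (hf : Continuous f) (e : M → ℕ)
    (he : ∀ x, e x ≠ 0) (hreg : ∀ x, x ∉ singularPoints f → e x = 1)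
    (hsing : ∀ x ∈ singularPoints f, IsLocallyPowerAt f (e x) x)
    {b : Metric.sphere (0 : EuclideanSpace ℝ (Fin 3)) 1} (p : M) (hb : b ≠ f p)
    (hval : ∀ x ∈ singularPoints f, f x = f p ∨ f x = b) : ∃ x, f x = b ∧ e x = e p := by
  obtain ⟨g, hg⟩ := exists_isPuncturedUniversalCover_sphere hb
  have hpow : ∀ x, IsLocallyPowerAt f (e x) x := by
    intro x
    by_cases hx : x ∈ singularPoints f
    · exact hsing x hx
    · rw [hreg x hx]
      exact (not_not.1 hx).isLocallyPowerAt
  refine hg.exists_exponent_eq hf (IsLocalHomeomorphOn.mk f _ fun x hx => ?_) hb.symm e he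
    (fun x _ => hpow x) (fun x _ => hpow x) p rfl
  exact (not_not.1 fun h => hx (hval x h)).exists_openPartialHomeomorph

theorem exists_ne_sphere (a : Metric.sphere (0 : EuclideanSpace ℝ (Fin 3)) 1) : ∃ b, b ≠ a :=
  ⟨-a, fun h => by
    have h1 : (-a : EuclideanSpace ℝ (Fin 3)) = a := congrArg Subtype.val h
    have h2 : (a : EuclideanSpace ℝ (Fin 3)) = 0 := by
      ext i
      have := congrArg (fun v : EuclideanSpace ℝ (Fin 3) => v i) h1
      simp only [PiLp.neg_apply] at this
      simp only [PiLp.zero_apply]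
      linarith
    have h3 := norm_eq_of_mem_sphere a
    rw [h2, norm_zero] at h3
    exact zero_ne_one h3⟩

theorem mainTheorem9 (k : ℕ)
    {M : Type*} [TopologicalSpace M] [T2Space M] [CompactSpace M]
    [ChartedSpace (EuclideanSpace ℝ (Fin 2)) M] [IsManifold (𝓡 2) ∞ M]
    (oM : SurfaceOrientation M)
    (oS : SurfaceOrientation (Metric.sphere (0 : EuclideanSpace ℝ (Fin 3)) 1))
    (f : M → Metric.sphere (0 : EuclideanSpace ℝ (Fin 3)) 1)
    (hf : IsSimpleBranchedCovering k oM oS f) :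
    (¬ ∃ p : M, singularPoints f = {p}) ∧
    (¬ ∃ (p q : M) (j h : ℕ), p ≠ q ∧ j ≠ h ∧ singularPoints f = {p, q} ∧
      HasPowerSingularity f j p ∧ HasPowerSingularity f h q) := by
  classical
  obtain ⟨-, hsm, Vs, Vt, es, et, hV, -, -, hes, het, -, hloc, -, -, hpow⟩ := hf
  have hcont : Continuous f := hsm.continuous
  refine ⟨?_, ?_⟩
  · rintro ⟨p, hp⟩
    have hps : p ∈ singularPoints f := hp ▸ mem_singleton p
    obtain ⟨j, hj, hpj⟩ : ∃ j ∈ Icc 2 k, p ∈ Vs j := by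
      by_contra! h
      exact hps (hloc p h)
    have hfp : f p ∈ Vt j := (hV j hj).2.2.mapsTo hpj
    have hpp : HasPowerSingularity f j p := ⟨hj.1, es j p, et j (f p), ((hes j hj).1 p hpj).1,
      ((het j hj).1 _ hfp).1, ((hes j hj).1 p hpj).2, ((het j hj).1 _ hfp).2, hpow j hj p hpj⟩
    obtain ⟨b, hb⟩ := exists_ne_sphere (f p)
    obtain ⟨x, hx, hxe⟩ := exists_exponent_eq_of_sphere hcont (fun x => if x = p then j else 1)
      (fun x => by have := hj.1; split_ifs <;> lia)
      (fun x hx => if_neg fun h => hx (h ▸ hps))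
      (fun x hx => by
        rw [hp] at hx
        obtain rfl : x = p := hx
        rw [if_pos rfl]
        exact hpp.isLocallyPowerAt) p hb
      (fun x hx => by rw [hp] at hx; exact Or.inl (congrArg f hx))
    have hxp : x ≠ p := fun h => hb (by rw [← hx, h])
    have := hj.1
    simp only [if_neg hxp, if_true] at hxe
    lia
  · rintro ⟨p, q, j, h, hpq, hjh, hs, hp, hq⟩
    have hj := hp.1
    have hh := hq.1
    let e : M → ℕ := fun x => if x = p then j else if x = q then h else 1
    have hep : e p = j := if_pos rfl
    have heq : e q = h := by simp [e, hpq.symm]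
    -- If `p` and `q` share their value, any other `b` works and has no singular point above it.
    obtain ⟨b, hb, hval⟩ : ∃ b, b ≠ f p ∧ (f q = f p ∨ f q = b) := by
      by_cases hfpq : f q = f p
      · obtain ⟨b, hb⟩ := exists_ne_sphere (f p)
        exact ⟨b, hb, Or.inl hfpq⟩
      · exact ⟨f q, hfpq, Or.inr rfl⟩
    obtain ⟨x, hx, hxe⟩ := exists_exponent_eq_of_sphere hcont e
      (fun x => by dsimp only [e]; split_ifs <;> lia)
      (fun x hx => by
        rw [hs, mem_insert_iff, mem_singleton_iff, not_or] at hx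
        simp [e, hx.1, hx.2])
      (fun x hx => by
        rw [hs] at hx
        rcases hx with rfl | rfl
        · rw [hep]; exact hp.isLocallyPowerAt
        · rw [heq]; exact hq.isLocallyPowerAt) p hb
      (fun x hx => by
        rw [hs] at hx
        rcases hx with rfl | rfl
        · exact Or.inl rfl
        · exact hval)
    have hxp : x ≠ p := fun h => hb (by rw [← hx, h])
    rw [hep] at hxe
    -- A point over `b` has degree `h` (if it is `q`) or 1, never `j`.
    by_cases hxq : x = q
    · exact hjh (by rw [← hxe, hxq, heq])
    · have : e x = 1 := by simp [e, hxp, hxq]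
      lia
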